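/- Let $G$ be a connected complex simple Lie group, realised as a closed subgroup $G\subset GL(V)$ of a finite-dimensional complex vector space $V$ (every such group is linear algebraic), with Lie algebra $\mathfrak g\subset\mathfrak{gl}(V)$. Fix a Cartan subalgebra $\mathfrak h$ and a base of the root system, and let $\mathfrak g=\mathfrak n_-\oplus\mathfrak h\oplus\mathfrak n_+$ be the triangular decomposition, $\mathfrak b_+=\mathfrak h\oplus\mathfrak n_+$, and $H\subset B^+\subset G$ the connected subgroups with Lie algebras $\mathfrak h\subset\mathfrak b_+$. Let $\kappa$ be a nondegenerate invariant symmetric bilinear form on $\mathfrak g$ (for instance the Killing form), let $r_0\in\mathfrak h\otimes\mathfrak h$ and $r_1\in\mathfrak n_+\otimes\mathfrak n_-$ be the canonical elements with respect to $\kappa$ (so $r_1=\sum_{\alpha>0}e_\alpha\otimes f_\alpha$ for root vectors with $\kappa(e_\alpha,f_\alpha)=1$), and let $r=\tfrac12 r_0+r_1$. For a holomorphic function $F$ write $$\langle\xi,dF\rangle(x)=\tfrac{d}{dt}F(e^{t\xi}x)\big|_{t=0},\qquad \langle\xi,d'F\rangle(x)=\tfrac{d}{dt}F(xe^{t\xi})\big|_{t=0}$$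 for its left and right differentials. The standard Poisson structure on $G$ is $$\{F_1,F_2\}=\langle r,dF_1\otimes dF_2\rangle-\langle r,d'F_1\otimes d'F_2\rangle ,$$ and the standard Poisson structure on $B^+$ is the one for which the inclusion $B^+\hookrightarrow G$ is Poisson: $\{f,g\}(x)=\{F_1,F_2\}(x)$ for $x\in B^+$ and any holomorphic functions $F_1,F_2$ on $G$ near $x$ that extend $f,g$ from $B^+$. \textbf{Theorem.} Let $U\subset B^+$ be open and let $f,g$ be holomorphic functions on $U$ that are $\mathrm{Ad}_H$-invariant, i.e. $f(hxh^{-1})=f(x)$ and $g(hxh^{-1})=g(x)$ whenever $h\in H$ and $x,\,hxh^{-1}\in U$. Then for every $x\in U$ the bracket $\{f,g\}(x)$ is well defined (local extensions exist and the value does not depend on them), and $$\{f,g\}(x)=\big\langle(\mathrm{id}\otimes\mathrm{Ad}_{x^{-1}})(r_1),\ d_+f\otimes\partial'_+g\big\rangle(x).$$ Here $d_+f$ is the left differential of $f$ at $x$ in the directions of $\mathfrak n_+$, and $\partial'_+g$ is the right differential of $g$ at $x$ projected on $\mathfrak n_+$; both are regarded as linear forms on $\mathfrak g$ that vanish on $\mathfrak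 h\oplus\mathfrak n_-$. -/

import Mathlib

open scoped TensorProduct Topology

noncomputable section

namespace StandardPoisson

/-! ### Triangular decomposition and the standard classical r-matrix -/

section LieAlgebraPart

open LieAlgebra LieAlgebra.IsKilling LieModule

variable {L : Type*} [LieRing L] [LieAlgebra ℂ L] [FiniteDimensional ℂ L] [IsKilling ℂ L]
variable {𝔥 : LieSubalgebra ℂ L} [𝔥.IsCartanSubalgebra]

/-- The sum of the weight spaces of `L` (with respect to `𝔥`) for the weights in `S`. -/
def weightSum (S : Set (Weight ℂ 𝔥 L)) : Submodule ℂ L :=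
  ⨆ α ∈ S, (rootSpace 𝔥 α).toSubmodule

/-- The positive roots relative to the base `Δ` of the root system of `(L, 𝔥)`. -/
def posRoots (Δ : (rootSystem 𝔥).Base) : Set (Weight ℂ 𝔥 L) :=
  {α | ∃ h : α ∈ 𝔥.root, Δ.IsPos ⟨α, h⟩}

/-- The negative roots. -/
def negRoots (Δ : (rootSystem 𝔥).Base) : Set (Weight ℂ 𝔥 L) :=
  {α | -α ∈ posRoots Δ}

/-- `𝔫₊`, the sum of the positive root spaces. -/
def nPos (Δ : (rootSystem 𝔥).Base) : Submodule ℂ L := weightSum (posRoots Δ)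

/-- `𝔫₋`, the sum of the negative root spaces. -/
def nNeg (Δ : (rootSystem 𝔥).Base) : Submodule ℂ L := weightSum (negRoots Δ)

/-- The Borel subalgebra `𝔟₊ = 𝔥 ⊕ 𝔫₊`. -/
def bPos (Δ : (rootSystem 𝔥).Base) : Submodule ℂ L := 𝔥.toSubmodule ⊔ nPos Δ

lemma disjoint_weightSum {S T : Set (Weight ℂ 𝔥 L)} (h : Disjoint S T) :
    Disjoint (weightSum S) (weightSum T) :=
  (LieSubmodule.iSupIndep_toSubmodule.mpr
    (iSupIndep_genWeightSpace' ℂ 𝔥 L)).disjoint_biSup_biSup h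

lemma cartan_eq_weightSum : 𝔥.toSubmodule = weightSum {α : Weight ℂ 𝔥 L | α.IsZero} := by
  have h0 : rootSpace 𝔥 (0 : 𝔥 → ℂ) = 𝔥.toLieSubmodule := rootSpace_zero_eq ℂ L 𝔥
  apply le_antisymm
  · intro x hx
    by_cases hb : rootSpace 𝔥 (0 : 𝔥 → ℂ) = ⊥
    · have hx' : x ∈ rootSpace 𝔥 (0 : 𝔥 → ℂ) := by rw [h0]; exact hx
      rw [hb] at hx'
      rw [(LieSubmodule.mem_bot x).mp hx']
      exact zero_mem _
    · have hle := le_biSup (fun α : Weight ℂ 𝔥 L ↦ (rootSpace 𝔥 α).toSubmodule)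
        (i := ⟨0, hb⟩) (s := {α : Weight ℂ 𝔥 L | α.IsZero}) rfl
      refine hle ?_
      change x ∈ rootSpace 𝔥 (0 : 𝔥 → ℂ)
      rw [h0]; exact hx
  · refine iSup₂_le fun α hα x hx ↦ ?_
    have hα' : (α : 𝔥 → ℂ) = 0 := hα
    have hx' : x ∈ rootSpace 𝔥 (α : 𝔥 → ℂ) := hx
    rw [hα', h0] at hx'
    exact hx'

lemma weightSum_univ : weightSum (Set.univ : Set (Weight ℂ 𝔥 L)) = ⊤ := by
  have h := iSup_genWeightSpace_eq_top' ℂ 𝔥 L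
  rw [← LieSubmodule.iSup_toSubmodule_eq_top] at h
  simpa [weightSum] using h

lemma weightSum_union (S T : Set (Weight ℂ 𝔥 L)) :
    weightSum (S ∪ T) = weightSum S ⊔ weightSum T :=
  iSup_union

lemma isPos_neg_iff (Δ : (rootSystem 𝔥).Base) {α : Weight ℂ 𝔥 L} (hα : α ∈ 𝔥.root)
    (hα' : -α ∈ 𝔥.root) : Δ.IsPos ⟨-α, hα'⟩ ↔ ¬ Δ.IsPos ⟨α, hα⟩ := by
  have h : (rootSystem 𝔥).reflectionPerm ⟨α, hα⟩ ⟨α, hα⟩ = ⟨-α, hα'⟩ := by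
    apply (rootSystem 𝔥).root.injective
    rw [RootPairing.root_reflectionPerm, RootPairing.reflection_apply_self]
    simp
  have h2 := RootPairing.Base.IsPos.neg_iff_not Δ (⟨α, hα⟩ : 𝔥.root)
  rw [← h2, ← h]
  rfl

lemma mem_posRoots_or_mem_negRoots (Δ : (rootSystem 𝔥).Base) (α : Weight ℂ 𝔥 L) :
    α ∈ posRoots Δ ∨ α.IsZero ∨ α ∈ negRoots Δ := by
  by_cases h0 : α.IsZero
  · exact Or.inr (Or.inl h0)
  · have hα : α ∈ 𝔥.root := by simpa using h0
    have hα' : -α ∈ 𝔥.root := by simpa using h0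
    by_cases h : Δ.IsPos ⟨α, hα⟩
    · exact Or.inl ⟨hα, h⟩
    · exact Or.inr (Or.inr ⟨hα', (isPos_neg_iff Δ hα hα').mpr h⟩)

lemma disjoint_posRoots (Δ : (rootSystem 𝔥).Base) :
    Disjoint (posRoots Δ) ({α | α.IsZero} ∪ negRoots Δ) := by
  rw [Set.disjoint_left]
  rintro α ⟨hα, hp⟩ (h | ⟨hn, h⟩)
  · exact (by simpa using hα : α.IsNonZero) h
  · exact (isPos_neg_iff Δ hα hn).mp h hp

lemma isCompl_nPos (Δ : (rootSystem 𝔥).Base) : IsCompl (nPos Δ) (𝔥.toSubmodule ⊔ nNeg Δ) := by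
  have h : 𝔥.toSubmodule ⊔ nNeg Δ = weightSum ({α : Weight ℂ 𝔥 L | α.IsZero} ∪ negRoots Δ) := by
    rw [weightSum_union, ← cartan_eq_weightSum, nNeg]
  rw [h]
  refine ⟨disjoint_weightSum (disjoint_posRoots Δ), codisjoint_iff.mpr ?_⟩
  rw [nPos, ← weightSum_union, ← weightSum_univ (𝔥 := 𝔥)]
  congr 1
  exact Set.eq_univ_of_forall fun α ↦ mem_posRoots_or_mem_negRoots Δ α

/-- The projection of `L = 𝔫₊ ⊕ (𝔥 ⊕ 𝔫₋)` onto `𝔫₊`. -/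
def projPos (Δ : (rootSystem 𝔥).Base) : L →ₗ[ℂ] nPos Δ :=
  (nPos Δ).projectionOnto _ (isCompl_nPos Δ)

variable (L) in
/-- A nondegenerate invariant symmetric bilinear form on `L`. -/
structure InvForm where
  form : LinearMap.BilinForm ℂ L
  symm : form.IsSymm
  nondegenerate : form.Nondegenerate
  invariant : form.lieInvariant L

lemma form_eq_zero (κ : InvForm L) {α β : Weight ℂ 𝔥 L} (h : β ≠ -α) {x y : L}
    (hx : x ∈ rootSpace 𝔥 α) (hy : y ∈ rootSpace 𝔥 β) : κ.form x y = 0 := by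
  obtain ⟨t, ht⟩ : ∃ t : 𝔥, α t + β t ≠ 0 := by
    by_contra! hc
    refine h (Weight.ext fun t ↦ ?_)
    rw [Weight.coe_neg, Pi.neg_apply]
    linear_combination hc t
  have h1 := κ.invariant (t : L) x y
  have hx' : ⁅(t : L), x⁆ = α t • x := lie_eq_smul_of_mem_rootSpace hx t
  have hy' : ⁅(t : L), y⁆ = β t • y := lie_eq_smul_of_mem_rootSpace hy t
  rw [hx', hy', map_smul, map_smul, LinearMap.smul_apply, smul_eq_mul, smul_eq_mul] at h1
  have h2 : (α t + β t) * κ.form x y = 0 := by linear_combination h1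
  exact (mul_eq_zero.mp h2).resolve_left ht

lemma form_injective (κ : InvForm L) (S : Set (Weight ℂ 𝔥 L)) {x : L} (hx : x ∈ weightSum S)
    (h : ∀ y ∈ weightSum {α : Weight ℂ 𝔥 L | -α ∈ S}, κ.form x y = 0) : x = 0 := by
  refine κ.nondegenerate.1 x fun y ↦ ?_
  have hy : y ∈ weightSum (Set.univ : Set (Weight ℂ 𝔥 L)) := by
    rw [weightSum_univ]; exact Submodule.mem_top
  have hle : weightSum (Set.univ : Set (Weight ℂ 𝔥 L)) ≤ LinearMap.ker (κ.form x) := by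
    refine iSup₂_le fun β _ z hz ↦ ?_
    by_cases hβ : -β ∈ S
    · exact h z (le_biSup (fun α : Weight ℂ 𝔥 L ↦ (rootSpace 𝔥 α).toSubmodule)
        (i := β) (s := {α : Weight ℂ 𝔥 L | -α ∈ S}) hβ hz)
    · have hle' : weightSum S ≤ LinearMap.ker (κ.form.flip z) := by
        refine iSup₂_le fun α hα w hw ↦ ?_
        refine form_eq_zero κ (α := α) (β := β) ?_ hw hz
        rintro rfl
        exact hβ (by simpa using hα)
      exact hle' hx
  exact hle hy

lemma isPerfPair_weightSum (κ : InvForm L) (S : Set (Weight ℂ 𝔥 L)) :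
    (κ.form.domRestrict₁₂ (weightSum S) (weightSum {α | -α ∈ S})).IsPerfPair := by
  refine LinearMap.IsPerfPair.of_injective ?_ ?_
  · refine (injective_iff_map_eq_zero _).mpr fun x hx ↦ Subtype.ext ?_
    exact form_injective κ S x.2 fun y hy ↦ LinearMap.congr_fun hx ⟨y, hy⟩
  · refine (injective_iff_map_eq_zero _).mpr fun x hx ↦ Subtype.ext ?_
    refine form_injective κ {α | -α ∈ S} x.2 fun y hy ↦ ?_
    rw [← κ.symm.eq]
    refine LinearMap.congr_fun hx ⟨y, ?_⟩
    simpa using hy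

lemma isPerfPair_nPos_nNeg (κ : InvForm L) (Δ : (rootSystem 𝔥).Base) :
    (κ.form.domRestrict₁₂ (nPos Δ) (nNeg Δ)).IsPerfPair :=
  isPerfPair_weightSum κ (posRoots Δ)

lemma isPerfPair_cartan (κ : InvForm L) (𝔥 : LieSubalgebra ℂ L) [𝔥.IsCartanSubalgebra] :
    (κ.form.domRestrict₁₂ 𝔥.toSubmodule 𝔥.toSubmodule).IsPerfPair := by
  have h := isPerfPair_weightSum κ {α : Weight ℂ 𝔥 L | α.IsZero}
  have h' : {α : Weight ℂ 𝔥 L | -α ∈ {α : Weight ℂ 𝔥 L | α.IsZero}} = {α | α.IsZero} := by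
    ext α; simp
  rw [h'] at h
  rw [cartan_eq_weightSum (𝔥 := 𝔥)]
  exact h

/-- The canonical element of `A ⊗ A'`, seen in `L ⊗ L`, for subspaces `A`, `A'` of `L` in perfect
duality under `κ`: the image of `id_A ∈ A ⊗ A^*` under the identification `A^* ≃ A'` given by
`κ`. It is `∑ aᵢ ⊗ aⁱ` for any basis `aᵢ` of `A` and the `κ`-dual basis `aⁱ` of `A'`. -/
def canonicalElement (κ : InvForm L) (A A' : Submodule ℂ L)
    (h : (κ.form.domRestrict₁₂ A A').IsPerfPair) : L ⊗[ℂ] L :=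
  letI := h.flip
  TensorProduct.map A.subtype
    (A'.subtype ∘ₗ ((κ.form.domRestrict₁₂ A A').flip.toPerfPair.symm.toLinearMap))
    (coevaluation ℂ A 1)

lemma coevaluation_eq_sum {A : Type*} [AddCommGroup A] [Module ℂ A] [FiniteDimensional ℂ A]
    {ι : Type*} [Fintype ι] [DecidableEq ι] (a : Module.Basis ι ℂ A) :
    coevaluation ℂ A 1 = ∑ i, a i ⊗ₜ[ℂ] a.coord i := by
  apply (TensorProduct.comm ℂ A (Module.Dual ℂ A)).injective
  apply (dualTensorHomEquivOfBasis (N := A) a).injective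
  rw [dualTensorHomEquivOfBasis_apply, dualTensorHomEquivOfBasis_apply,
    coevaluation_apply_one]
  ext x
  have h1 := (Module.Basis.ofVectorSpace ℂ A).sum_repr x
  have h2 := a.sum_repr x
  simp only [map_sum, TensorProduct.comm_tmul, LinearMap.sum_apply, dualTensorHom_apply,
    Module.Basis.coord_apply, h1, h2]

lemma canonicalElement_eq_sum (κ : InvForm L) (A A' : Submodule ℂ L)
    (h : (κ.form.domRestrict₁₂ A A').IsPerfPair) {ι : Type*} [Fintype ι] [DecidableEq ι]
    (a : Module.Basis ι ℂ A) (a' : ι → A')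
    (haa' : ∀ i j, κ.form (a i : L) (a' j : L) = if i = j then 1 else 0) :
    canonicalElement κ A A' h = ∑ i, (a i : L) ⊗ₜ[ℂ] (a' i : L) := by
  let _ := h.flip
  have ha' : ∀ i, (κ.form.domRestrict₁₂ A A').flip.toPerfPair.symm (a.coord i) = a' i := by
    intro i
    rw [LinearEquiv.symm_apply_eq]
    refine a.ext fun j ↦ ?_
    have h1 : (κ.form.domRestrict₁₂ A A') (a j) (a' i) = if j = i then 1 else 0 := haa' j i
    simp [h1, Finsupp.single_apply]
  simp [canonicalElement, coevaluation_eq_sum a, ha']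

/-- `r₀`, the canonical element of `𝔥 ⊗ 𝔥`. -/
def rZero (κ : InvForm L) (𝔥 : LieSubalgebra ℂ L) [𝔥.IsCartanSubalgebra] : L ⊗[ℂ] L :=
  canonicalElement κ 𝔥.toSubmodule 𝔥.toSubmodule (isPerfPair_cartan κ 𝔥)

/-- `r₁`, the canonical element of `𝔫₊ ⊗ 𝔫₋`. -/
def rOne (κ : InvForm L) (Δ : (rootSystem 𝔥).Base) : L ⊗[ℂ] L :=
  canonicalElement κ (nPos Δ) (nNeg Δ) (isPerfPair_nPos_nNeg κ Δ)

/-- The standard classical r-matrix `r = ½ r₀ + r₁`. -/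
def rStd (κ : InvForm L) (Δ : (rootSystem 𝔥).Base) : L ⊗[ℂ] L :=
  (1 / 2 : ℂ) • rZero κ 𝔥 + rOne κ Δ

end LieAlgebraPart

/-! ### Complex matrix groups, differentials and brackets -/

section GroupPart

lemma exp_conj_mem {A : Type*} [NormedRing A] [NormedAlgebra ℂ A] [CompleteSpace A]
    (W : Submodule ℂ A) (hW : IsClosed (W : Set A)) {ξ a : A}
    (hξ : ∀ c ∈ W, ξ * c - c * ξ ∈ W) (ha : a ∈ W) :
    NormedSpace.exp ξ * a * NormedSpace.exp (-ξ) ∈ W := by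
  let l : A →L[ℂ] A := ContinuousLinearMap.mul ℂ _ ξ
  let r : A →L[ℂ] A := (ContinuousLinearMap.mul ℂ _).flip (-ξ)
  have hl : ∀ (n : ℕ) (c : A), (l ^ n) c = ξ ^ n * c := by
    intro n; induction n with
    | zero => intro c; simp
    | succ n ih => intro c; rw [pow_succ, pow_succ, mul_apply_eq_comp, ih]; simp [l, mul_assoc]
  have hr : ∀ (n : ℕ) (c : A), (r ^ n) c = c * (-ξ) ^ n := by
    intro n; induction n with
    | zero => intro c; simp
    | succ n ih =>
      intro c; rw [pow_succ, pow_succ', mul_apply_eq_comp, ih]; simp [r, mul_assoc]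
  have hel : ∀ c, NormedSpace.exp l c = NormedSpace.exp ξ * c := by
    intro c
    have h1 := ((ContinuousLinearMap.apply ℂ A c).hasSum
      (NormedSpace.exp_series_hasSum_exp' (𝕂 := ℂ) l))
    have h2 := (NormedSpace.exp_series_hasSum_exp' (𝕂 := ℂ) ξ).mul_right c
    have e : (fun b : ℕ ↦ ContinuousLinearMap.apply ℂ A c ((b.factorial : ℂ)⁻¹ • l ^ b)) =
        fun i : ℕ ↦ (i.factorial : ℂ)⁻¹ • ξ ^ i * c := by
      funext n
      simp [hl]
    rw [e] at h1
    exact h1.unique h2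
  have her : ∀ c, NormedSpace.exp r c = c * NormedSpace.exp (-ξ) := by
    intro c
    have h1 := ((ContinuousLinearMap.apply ℂ A c).hasSum
      (NormedSpace.exp_series_hasSum_exp' (𝕂 := ℂ) r))
    have h2 := (NormedSpace.exp_series_hasSum_exp' (𝕂 := ℂ) (-ξ)).mul_left c
    have e : (fun b : ℕ ↦ ContinuousLinearMap.apply ℂ A c ((b.factorial : ℂ)⁻¹ • r ^ b)) =
        fun i : ℕ ↦ c * (i.factorial : ℂ)⁻¹ • (-ξ) ^ i := by
      funext n
      simp [hr]
    rw [e] at h1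
    exact h1.unique h2
  have hc : Commute r l := by
    refine ContinuousLinearMap.ext fun c ↦ ?_
    simp [l, r, mul_assoc]
  have hT : ∀ n : ℕ, ((r + l) ^ n) a ∈ W := by
    intro n; induction n with
    | zero => simpa using ha
    | succ n ih =>
      rw [pow_succ', mul_apply_eq_comp]
      have h3 : (r + l) (((r + l) ^ n) a) = ξ * ((r + l) ^ n) a - ((r + l) ^ n) a * ξ := by
        simp [l, r]; abel
      rw [h3]
      exact hξ _ ih
  let _ : NormedAlgebra ℚ (A →L[ℂ] A) := NormedAlgebra.restrictScalars ℚ ℂ _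
  have hs := ((ContinuousLinearMap.apply ℂ A a).hasSum
      (NormedSpace.exp_series_hasSum_exp' (𝕂 := ℂ) (r + l)))
  rw [NormedSpace.exp_add_of_commute hc] at hs
  simp only [ContinuousLinearMap.apply_apply, mul_apply_eq_comp, hel, her] at hs
  refine hW.mem_of_tendsto hs (Filter.Eventually.of_forall fun s ↦ ?_)
  refine Submodule.sum_mem _ fun n _ ↦ ?_
  simpa using W.smul_mem ((n.factorial : ℂ)⁻¹) (hT n)

variable {V : Type*} [NormedAddCommGroup V] [NormedSpace ℂ V] [FiniteDimensional ℂ V]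

/-- `gl(V)` with the commutator bracket. -/
instance (priority := 100) instLieRingGl : LieRing (V →L[ℂ] V) := LieRing.ofAssociativeRing

/-- `e^ξ` as an element of `GL(V)`. -/
def expUnit (ξ : V →L[ℂ] V) : (V →L[ℂ] V)ˣ :=
  haveI : CompleteSpace V := FiniteDimensional.complete ℂ V
  letI : NormedAlgebra ℚ (V →L[ℂ] V) := NormedAlgebra.restrictScalars ℚ ℂ _
  { val := NormedSpace.exp ξ
    inv := NormedSpace.exp (-ξ)
    val_inv := by
      rw [← NormedSpace.exp_add_of_commute (Commute.neg_right (Commute.refl ξ))]; simp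
    inv_val := by
      rw [← NormedSpace.exp_add_of_commute (Commute.neg_left (Commute.refl ξ))]; simp }

/-- The connected subgroup of `GL(V)` generated by the elements `e^ξ`, `ξ ∈ 𝔨`. It carries the
subspace topology of `GL(V)`. -/
def expGroup (𝔨 : Submodule ℂ (V →L[ℂ] V)) : Subgroup (V →L[ℂ] V)ˣ :=
  Subgroup.closure (expUnit '' 𝔨)

lemma expGroup_mono {𝔨 𝔩 : Submodule ℂ (V →L[ℂ] V)} (h : 𝔨 ≤ 𝔩) : expGroup 𝔨 ≤ expGroup 𝔩 :=
  Subgroup.closure_mono (Set.image_mono h)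

/-- The exponential map `𝔨 → K` of the group `K = expGroup 𝔨`. -/
def expK {𝔨 : Submodule ℂ (V →L[ℂ] V)} (ξ : 𝔨) : expGroup 𝔨 :=
  ⟨expUnit ξ, Subgroup.subset_closure ⟨ξ, ξ.2, rfl⟩⟩

/-- A function on a (closed) subgroup `K` of `GL(V)` is holomorphic at `x ∈ K` if near `x` it is
the restriction of a holomorphic function on a neighbourhood of `x` in `End V`. -/
def HolomorphicAt {K : Subgroup (V →L[ℂ] V)ˣ} (f : K → ℂ) (x : K) : Prop :=
  ∃ F : (V →L[ℂ] V) → ℂ, AnalyticAt ℂ F ((x : (V →L[ℂ] V)ˣ) : V →L[ℂ] V) ∧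
    ∀ᶠ y in 𝓝 x, f y = F ((y : (V →L[ℂ] V)ˣ) : V →L[ℂ] V)

/-- The differential at `0` of a function on a normed space. -/
def diffZero {E : Type*} [NormedAddCommGroup E] [NormedSpace ℂ E] (φ : E → ℂ) : E →ₗ[ℂ] ℂ :=
  (fderiv ℂ φ 0).toLinearMap

/-- The left differential `df(x) ∈ 𝔨^*`, `⟨ξ, df⟩(x) = d/dt f(e^{tξ} x)` at `t = 0`. -/
def diffLeft {𝔨 : Submodule ℂ (V →L[ℂ] V)} (f : expGroup 𝔨 → ℂ) (x : expGroup 𝔨) :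
    𝔨 →ₗ[ℂ] ℂ :=
  diffZero fun ξ : 𝔨 ↦ f (expK ξ * x)

/-- The right differential `d'f(x) ∈ 𝔨^*`, `⟨ξ, d'f⟩(x) = d/dt f(x e^{tξ})` at `t = 0`. -/
def diffRight {𝔨 : Submodule ℂ (V →L[ℂ] V)} (f : expGroup 𝔨 → ℂ) (x : expGroup 𝔨) :
    𝔨 →ₗ[ℂ] ℂ :=
  diffZero fun ξ : 𝔨 ↦ f (x * expK ξ)

/-- `⟨t, φ ⊗ ψ⟩` for `t ∈ L ⊗ L` and `φ, ψ ∈ L^*`. -/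
def pairing {L : Type*} [AddCommGroup L] [Module ℂ L] (t : L ⊗[ℂ] L) (φ ψ : L →ₗ[ℂ] ℂ) : ℂ :=
  TensorProduct.dualDistrib ℂ L L (φ ⊗ₜ[ℂ] ψ) t

variable (𝔤 : LieSubalgebra ℂ (V →L[ℂ] V))

/-- The connected subgroup `G ⊆ GL(V)` with Lie algebra `𝔤 ⊆ gl(V)`. -/
abbrev groupG : Subgroup (V →L[ℂ] V)ˣ := expGroup 𝔤.toSubmodule

variable {𝔤}

lemma conj_expUnit_mem {ξ a : V →L[ℂ] V} (hξ : ξ ∈ 𝔤) (ha : a ∈ 𝔤) :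
    NormedSpace.exp ξ * a * NormedSpace.exp (-ξ) ∈ 𝔤 := by
  have : CompleteSpace V := FiniteDimensional.complete ℂ V
  exact exp_conj_mem 𝔤.toSubmodule (Submodule.closed_of_finiteDimensional _)
    (fun c hc ↦ 𝔤.lie_mem hξ hc) ha

lemma conj_mem (x : groupG 𝔤) {a : V →L[ℂ] V} (ha : a ∈ 𝔤) :
    (x : (V →L[ℂ] V)ˣ) * a * ((x⁻¹ : groupG 𝔤) : (V →L[ℂ] V)ˣ) ∈ 𝔤 := by
  obtain ⟨u, hu⟩ := x
  suffices h : ∀ a ∈ 𝔤, (u : V →L[ℂ] V) * a * (u⁻¹ : (V →L[ℂ] V)ˣ) ∈ 𝔤 ∧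
      ((u⁻¹ : (V →L[ℂ] V)ˣ) : V →L[ℂ] V) * a * u ∈ 𝔤 from (h a ha).1
  clear ha a
  induction hu using Subgroup.closure_induction with
  | mem v hv =>
    obtain ⟨ξ, hξ, rfl⟩ := hv
    intro a ha
    refine ⟨conj_expUnit_mem hξ ha, ?_⟩
    have h := conj_expUnit_mem (neg_mem hξ) ha
    rwa [neg_neg] at h
  | one => intro a ha; simpa using ha
  | mul v w _ _ hv hw =>
    intro a ha
    have h1 := (hv _ (hw a ha).1).1
    have h2 := (hw _ (hv a ha).2).2
    simp only [mul_inv_rev, Units.val_mul]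
    simp only [mul_assoc] at h1 h2 ⊢
    exact ⟨h1, h2⟩
  | inv v _ hv =>
    intro a ha
    rw [inv_inv]
    exact ⟨(hv a ha).2, (hv a ha).1⟩

/-- The adjoint action `Ad_x a = x a x⁻¹` of `x ∈ G` on `𝔤`. -/
def Ad (x : groupG 𝔤) : 𝔤 →ₗ[ℂ] 𝔤 where
  toFun a := ⟨_, conj_mem x a.2⟩
  map_add' a b := by ext1; simp [mul_add, add_mul]
  map_smul' c a := by ext1; simp

/-- A subspace of `𝔤` as a subspace of `gl(V)`. -/
abbrev ambient (𝔰 : Submodule ℂ 𝔤) : Submodule ℂ (V →L[ℂ] V) := 𝔰.map 𝔤.toSubmodule.subtype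

lemma ambient_le (𝔰 : Submodule ℂ 𝔤) : ambient 𝔰 ≤ 𝔤.toSubmodule :=
  Submodule.map_subtype_le _ _

variable [LieAlgebra.IsKilling ℂ 𝔤] {𝔥 : LieSubalgebra ℂ 𝔤} [𝔥.IsCartanSubalgebra]

/-- The Poisson bracket at `x ∈ G` of functions on `G` with the standard Poisson Lie structure:
`{F₁, F₂} = ⟨r, dF₁ ⊗ dF₂⟩ - ⟨r, d'F₁ ⊗ d'F₂⟩`. -/
def bracketG (κ : InvForm 𝔤) (Δ : (LieAlgebra.IsKilling.rootSystem 𝔥).Base)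
    (F₁ F₂ : groupG 𝔤 → ℂ) (x : groupG 𝔤) : ℂ :=
  pairing (rStd κ Δ) (diffLeft F₁ x) (diffLeft F₂ x) -
    pairing (rStd κ Δ) (diffRight F₁ x) (diffRight F₂ x)

/-- The Cartan subgroup `H`. -/
abbrev groupH (𝔥 : LieSubalgebra ℂ 𝔤) : Subgroup (V →L[ℂ] V)ˣ := expGroup (ambient 𝔥.toSubmodule)

/-- The Borel subgroup `B⁺`. -/
abbrev groupB (Δ : (LieAlgebra.IsKilling.rootSystem 𝔥).Base) : Subgroup (V →L[ℂ] V)ˣ :=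
  expGroup (ambient (bPos Δ))

/-- The inclusion `H → B⁺`. -/
def inclHB (Δ : (LieAlgebra.IsKilling.rootSystem 𝔥).Base) : groupH 𝔥 →* groupB Δ :=
  Subgroup.inclusion (expGroup_mono (Submodule.map_mono le_sup_left))

/-- The inclusion `B⁺ → G`. -/
def inclBG (Δ : (LieAlgebra.IsKilling.rootSystem 𝔥).Base) : groupB Δ →* groupG 𝔤 :=
  Subgroup.inclusion (expGroup_mono (ambient_le _))

/-- `F` is a local holomorphic extension to `G` near `x ∈ B⁺` of the function `f` on `B⁺`. -/
def IsExtensionAt (Δ : (LieAlgebra.IsKilling.rootSystem 𝔥).Base) (f : groupB Δ → ℂ)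
    (x : groupB Δ) (F : groupG 𝔤 → ℂ) : Prop :=
  HolomorphicAt F (inclBG Δ x) ∧ ∀ᶠ y in 𝓝 x, F (inclBG Δ y) = f y

/-- `c` is the value at `x ∈ B⁺` of the bracket `{f, g}` of two functions on `B⁺` for the standard
Poisson structure of `B⁺`, that is, the one for which `B⁺` is a Poisson submanifold of `G`: `c` is
the bracket `{F₁, F₂}(x)` on `G` of any local extensions `F₁`, `F₂` of `f`, `g`. -/
def HasBracketAt (κ : InvForm 𝔤) (Δ : (LieAlgebra.IsKilling.rootSystem 𝔥).Base)
    (f g : groupB Δ → ℂ) (x : groupB Δ) (c : ℂ) : Prop :=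
  (∃ F, IsExtensionAt Δ f x F) ∧ (∃ F, IsExtensionAt Δ g x F) ∧
    ∀ F₁ F₂ : groupG 𝔤 → ℂ, IsExtensionAt Δ f x F₁ → IsExtensionAt Δ g x F₂ →
      bracketG κ Δ F₁ F₂ (inclBG Δ x) = c

/-- The projection of `𝔤 = 𝔫₊ ⊕ (𝔥 ⊕ 𝔫₋)` onto `𝔫₊`, with values in `𝔟₊ ⊆ gl(V)`. -/
def projB (Δ : (LieAlgebra.IsKilling.rootSystem 𝔥).Base) : 𝔤 →ₗ[ℂ] ambient (bPos Δ) :=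
  LinearMap.codRestrict _ (𝔤.toSubmodule.subtype ∘ₗ (nPos Δ).subtype ∘ₗ projPos Δ) fun a ↦
    Submodule.mem_map_of_mem (Submodule.mem_sup_right (projPos Δ a).2)

/-- `d₊f(x)`: the left differential of `f` in the directions of `𝔫₊`, a linear form on `𝔫₊`
(extended to `𝔤` by zero on `𝔥 ⊕ 𝔫₋`). -/
def dPlus (Δ : (LieAlgebra.IsKilling.rootSystem 𝔥).Base) (f : groupB Δ → ℂ) (x : groupB Δ) :
    𝔤 →ₗ[ℂ] ℂ :=
  diffLeft f x ∘ₗ projB Δ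

/-- `∂'₊g(x)`: the right differential of `g` projected on `𝔫₊`, a linear form on `𝔫₊`
(extended to `𝔤` by zero on `𝔥 ⊕ 𝔫₋`). -/
def dPlus' (Δ : (LieAlgebra.IsKilling.rootSystem 𝔥).Base) (g : groupB Δ → ℂ) (x : groupB Δ) :
    𝔤 →ₗ[ℂ] ℂ :=
  diffRight g x ∘ₗ projB Δ

/-- `f` is invariant under conjugation by `H` on `U ⊆ B⁺`. -/
def AdHInvariantOn (Δ : (LieAlgebra.IsKilling.rootSystem 𝔥).Base) (f : groupB Δ → ℂ)
    (U : Set (groupB Δ)) : Prop :=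
  ∀ (h : groupH 𝔥) (x : groupB Δ), x ∈ U → inclHB Δ h * x * (inclHB Δ h)⁻¹ ∈ U →
    f (inclHB Δ h * x * (inclHB Δ h)⁻¹) = f x

end GroupPart

end StandardPoisson

end

/-! Write `A = Ad x` for `x ∈ B⁺`. Since `x a = (A a) x`, the right differential of a function on
`G` is its left differential composed with `A`. With `φ`, `ψ` the left differentials of the two
extensions, the bracket is `⟨r, φ ⊗ ψ⟩ - ⟨r, φA ⊗ ψA⟩`, and the theorem becomes linear algebra
(`pairing_rStd_sub`).

Three facts about `A` are needed: it is a `κ`-isometry (`form_Ad`), it preserves `𝔫₊`, and it acts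
trivially on `𝔟₊/𝔫₊` (`Ad_sub_mem_nPos`). Differentiating the `Ad_H`-invariance gives `φA = φ` and
`ψA = ψ` on `𝔥` (`fderiv_commutator_eq_zero`).

Let `v = p + h + n` represent `ψ` under `κ`; then `A⁻¹v = p' + h' + n'` represents `ψA`. Pairing
with `r` gives `φ(p) + ½φ(h)` and `φ(Ap') + ½φ(Ah')`. Invariance of `ψ` forces `h = h'`, invariance
of `φ` cancels the halves, and `φ(p - Ap')` remains. The right-hand side of the formula is `φ` of
the `𝔫₊`-part of `An'`; by `An' = v - Ah' - Ap'` that part is `p - Ap' - (Ah' - h')`, and `φ` kills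
the last term.

The result involves `φ` and `ψA` only on `𝔫₊ ⊆ 𝔟₊`, where they are differentials of `f` and `g`;
hence it does not depend on the extensions. -/

namespace StandardPoisson

/-! ### Canonical elements as pairings. -/

section LieAlgebraPart

open LieAlgebra LieAlgebra.IsKilling LieModule

/-- A canonical element pairs with `φ ⊗ ψ` by evaluating `φ` at the vector representing `ψ`. -/
lemma pairing_canonicalElement {L : Type*} [LieRing L] [LieAlgebra ℂ L] [FiniteDimensional ℂ L]
    [IsKilling ℂ L] (κ : InvForm L) (A A' : Submodule ℂ L)
    (h : (κ.form.domRestrict₁₂ A A').IsPerfPair) (φ ψ : L →ₗ[ℂ] ℂ) {p : L} (hp : p ∈ A)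
    (hψ : ∀ y ∈ A', κ.form p y = ψ y) :
    pairing (canonicalElement κ A A' h) φ ψ = φ p := by
  let _ := h.flip
  let a := Module.finBasis ℂ A
  let a' := fun i ↦ (κ.form.domRestrict₁₂ A A').flip.toPerfPair.symm (a.coord i)
  have haa' : ∀ i j, κ.form (a i : L) (a' j : L) = if i = j then 1 else 0 := by
    intro i j
    have h1 : (κ.form.domRestrict₁₂ A A').flip.toPerfPair (a' j) = a.coord j :=
      LinearEquiv.apply_symm_apply _ _
    have h2 := LinearMap.congr_fun h1 (a i)
    rw [Module.Basis.coord_apply, Module.Basis.repr_self, Finsupp.single_apply] at h2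
    exact h2
  rw [canonicalElement_eq_sum κ A A' h a a' haa']
  -- In dual bases, `ψ(a'ⱼ) = κ(p, a'ⱼ)` is the `j`-th coordinate of `p`, so `∑ φ(aⱼ) ψ(a'ⱼ)`
  -- reassembles `φ(p)`.
  have hc : ∀ j, ψ (a' j) = a.repr ⟨p, hp⟩ j := by
    intro j
    have h3 : κ.form p (a' j) = a.coord j ⟨p, hp⟩ :=
      LinearMap.congr_fun (LinearEquiv.apply_symm_apply
        (κ.form.domRestrict₁₂ A A').flip.toPerfPair (a.coord j)) ⟨p, hp⟩
    rw [← hψ _ (a' j).2, h3, Module.Basis.coord_apply]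
  have h4 : p = ∑ j, a.repr ⟨p, hp⟩ j • (a j : L) := by
    have h5 := congrArg A.subtype (a.sum_repr ⟨p, hp⟩)
    rw [map_sum] at h5
    exact h5.symm
  conv_rhs => rw [h4]
  simp [pairing, hc, mul_comm]

lemma pairing_map {L : Type*} [AddCommGroup L] [Module ℂ L] (a b : L →ₗ[ℂ] L) (t : L ⊗[ℂ] L)
    (φ ψ : L →ₗ[ℂ] ℂ) :
    pairing (TensorProduct.map a b t) φ ψ = pairing t (φ ∘ₗ a) (ψ ∘ₗ b) := by
  induction t using TensorProduct.induction_on with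
  | zero => simp [pairing]
  | tmul x y => simp [pairing]
  | add x y hx hy => simp only [pairing, map_add] at hx hy ⊢; rw [hx, hy]

variable {L : Type*} [LieRing L] [LieAlgebra ℂ L] [FiniteDimensional ℂ L] [IsKilling ℂ L]
variable {𝔥 : LieSubalgebra ℂ L} [𝔥.IsCartanSubalgebra]

/-! ### Orthogonality and brackets in the triangular decomposition. -/

lemma weightSum_induction {S : Set (Weight ℂ 𝔥 L)} {W : Submodule ℂ L}
    (h : ∀ α ∈ S, ∀ x ∈ rootSpace 𝔥 α, x ∈ W) : weightSum S ≤ W :=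
  iSup₂_le fun α hα x hx ↦ h α hα x hx

lemma rootSpace_le_weightSum {S : Set (Weight ℂ 𝔥 L)} {α : Weight ℂ 𝔥 L} (hα : α ∈ S) {x : L}
    (hx : x ∈ rootSpace 𝔥 α) : x ∈ weightSum S :=
  le_biSup (fun α : Weight ℂ 𝔥 L ↦ (rootSpace 𝔥 α).toSubmodule) hα hx

lemma form_eq_zero_of_weightSum (κ : InvForm L) {S T : Set (Weight ℂ 𝔥 L)}
    (h : ∀ α ∈ S, ∀ β ∈ T, β ≠ -α) {x y : L} (hx : x ∈ weightSum S) (hy : y ∈ weightSum T) :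
    κ.form x y = 0 := by
  have h1 : weightSum S ≤ LinearMap.ker (κ.form.flip y) := by
    refine weightSum_induction fun α hα z hz ↦ ?_
    have h2 : weightSum T ≤ LinearMap.ker (κ.form z) :=
      weightSum_induction fun β hβ w hw ↦ form_eq_zero κ (h α hα β hβ) hz hw
    exact h2 hy
  exact h1 hx

variable (Δ : (rootSystem 𝔥).Base)

lemma neg_notMem_posRoots {α : Weight ℂ 𝔥 L} (hα : α ∈ posRoots Δ) : -α ∉ posRoots Δ := by
  obtain ⟨h, hp⟩ := hα
  rintro ⟨h', hn⟩
  exact (isPos_neg_iff Δ h h').mp hn hp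

lemma not_isZero_of_mem_posRoots {α : Weight ℂ 𝔥 L} (hα : α ∈ posRoots Δ) : ¬ α.IsZero := by
  obtain ⟨h, -⟩ := hα
  simpa using h

lemma form_nPos_nPos (κ : InvForm L) {x y : L} (hx : x ∈ nPos Δ) (hy : y ∈ nPos Δ) :
    κ.form x y = 0 :=
  form_eq_zero_of_weightSum κ
    (fun _ hα _ hβ h ↦ neg_notMem_posRoots Δ hα (h ▸ hβ)) hx hy

lemma form_nPos_cartan (κ : InvForm L) {x y : L} (hx : x ∈ nPos Δ) (hy : y ∈ 𝔥) :
    κ.form x y = 0 := by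
  have hy' : y ∈ weightSum {α : Weight ℂ 𝔥 L | α.IsZero} :=
    cartan_eq_weightSum (𝔥 := 𝔥) ▸ hy
  refine form_eq_zero_of_weightSum κ (fun α hα β hβ h ↦ ?_) hx hy'
  subst h
  exact not_isZero_of_mem_posRoots Δ hα (by simpa using hβ)

lemma form_nNeg_nNeg (κ : InvForm L) {x y : L} (hx : x ∈ nNeg Δ) (hy : y ∈ nNeg Δ) :
    κ.form x y = 0 := by
  refine form_eq_zero_of_weightSum κ (fun α hα β hβ h ↦ ?_) hx hy
  subst h
  exact neg_notMem_posRoots Δ hα hβ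

lemma form_nNeg_cartan (κ : InvForm L) {x y : L} (hx : x ∈ nNeg Δ) (hy : y ∈ 𝔥) :
    κ.form x y = 0 := by
  have hy' : y ∈ weightSum {α : Weight ℂ 𝔥 L | α.IsZero} :=
    cartan_eq_weightSum (𝔥 := 𝔥) ▸ hy
  refine form_eq_zero_of_weightSum κ (fun α hα β hβ h ↦ ?_) hx hy'
  subst h
  have hβ' : α.IsZero := by simpa using hβ
  exact not_isZero_of_mem_posRoots Δ hα (by simpa using hβ')

lemma lie_cartan_nPos {x y : L} (hx : x ∈ 𝔥) (hy : y ∈ nPos Δ) : ⁅x, y⁆ ∈ nPos Δ := by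
  have h : nPos Δ ≤ (nPos Δ).comap (LieAlgebra.ad ℂ L x) :=
    weightSum_induction fun α hα z hz ↦ rootSpace_le_weightSum hα
      ((rootSpace 𝔥 (α : 𝔥 → ℂ)).lie_mem (x := (⟨x, hx⟩ : 𝔥)) hz)
  exact h hy

/-- For root vectors of positive roots `α`, `β`, the bracket has weight `α + β`. Either that weight
space is zero, or `α + β` is a weight, nonzero because `-α` is not positive, hence a positive root.
-/
lemma lie_nPos_nPos {x y : L} (hx : x ∈ nPos Δ) (hy : y ∈ nPos Δ) : ⁅x, y⁆ ∈ nPos Δ := by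
  have key : ∀ α ∈ posRoots Δ, ∀ β ∈ posRoots Δ, ∀ z ∈ rootSpace 𝔥 (α : 𝔥 → ℂ),
      ∀ w ∈ rootSpace 𝔥 (β : 𝔥 → ℂ), ⁅z, w⁆ ∈ nPos Δ := by
    intro α hα β hβ z hz w hw
    have hzw := lie_mem_genWeightSpace_of_mem_genWeightSpace hz hw
    by_cases hb : genWeightSpace L ((α : 𝔥 → ℂ) + (β : 𝔥 → ℂ)) = ⊥
    · rw [hb] at hzw
      rw [(LieSubmodule.mem_bot _).mp hzw]
      exact zero_mem _
    · let γ : Weight ℂ 𝔥 L := ⟨(α : 𝔥 → ℂ) + (β : 𝔥 → ℂ), hb⟩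
      have hγ : γ ∈ 𝔥.root := by
        suffices ¬ γ.IsZero by simpa using this
        intro h0
        have h1 : β = -α := by
          refine Weight.ext fun t ↦ ?_
          have h2 : α t + β t = 0 := congrFun h0 t
          rw [Weight.coe_neg, Pi.neg_apply]
          linear_combination h2
        exact neg_notMem_posRoots Δ hα (h1 ▸ hβ)
      refine rootSpace_le_weightSum (α := γ) ?_ hzw
      obtain ⟨hα1, hα2⟩ := hα
      obtain ⟨hβ1, hβ2⟩ := hβ
      refine ⟨hγ, RootPairing.Base.IsPos.add hα2 hβ2 ?_⟩
      ext t
      simp [γ]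
  have h1 : nPos Δ ≤ (nPos Δ).comap (LieAlgebra.ad ℂ L x) := by
    refine weightSum_induction fun β hβ w hw ↦ ?_
    have h2 : nPos Δ ≤ (nPos Δ).comap (LieAlgebra.ad ℂ L w) := by
      refine weightSum_induction fun α hα z hz ↦ ?_
      exact key β hβ α hα w hw z hz
    have h3 : ⁅w, x⁆ ∈ nPos Δ := h2 hx
    change ⁅x, w⁆ ∈ nPos Δ
    rw [← lie_skew]
    exact neg_mem h3
  exact h1 hy

lemma lie_bPos_nPos {x y : L} (hx : x ∈ bPos Δ) (hy : y ∈ nPos Δ) : ⁅x, y⁆ ∈ nPos Δ := by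
  obtain ⟨a, ha, b, hb, rfl⟩ := Submodule.mem_sup.mp hx
  rw [add_lie]
  exact add_mem (lie_cartan_nPos Δ ha hy) (lie_nPos_nPos Δ hb hy)

/-- Holds because `𝔥` is abelian. This is the infinitesimal form of the triviality of `Ad` of `B⁺`
on `𝔟₊/𝔫₊`. -/
lemma lie_bPos_bPos {x y : L} (hx : x ∈ bPos Δ) (hy : y ∈ bPos Δ) : ⁅x, y⁆ ∈ nPos Δ := by
  obtain ⟨c, hc, d, hd, rfl⟩ := Submodule.mem_sup.mp hy
  obtain ⟨a, ha, b, hb, rfl⟩ := Submodule.mem_sup.mp hx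
  have h0 : ⁅a, c⁆ = 0 :=
    congrArg Subtype.val (trivial_lie_zero 𝔥 𝔥 (⟨a, ha⟩ : 𝔥) (⟨c, hc⟩ : 𝔥))
  rw [lie_add, add_lie, h0, zero_add]
  refine add_mem ?_ (lie_bPos_nPos Δ hx hd)
  rw [← lie_skew]
  exact neg_mem (lie_cartan_nPos Δ hc hb)

lemma exists_triangular (v : L) :
    ∃ p ∈ nPos Δ, ∃ h ∈ 𝔥, ∃ n ∈ nNeg Δ, v = p + h + n := by
  have hv : v ∈ nPos Δ ⊔ (𝔥.toSubmodule ⊔ nNeg Δ) := by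
    rw [(isCompl_nPos Δ).sup_eq_top]; exact Submodule.mem_top
  obtain ⟨p, hp, w, hw, rfl⟩ := Submodule.mem_sup.mp hv
  obtain ⟨h, hh, n, hn, rfl⟩ := Submodule.mem_sup.mp hw
  exact ⟨p, hp, h, hh, n, hn, (add_assoc _ _ _).symm⟩

lemma projPos_of_mem_nPos {x : L} (hx : x ∈ nPos Δ) : (projPos Δ x : L) = x :=
  congrArg Subtype.val (Submodule.projectionOnto_apply_left (isCompl_nPos Δ) ⟨x, hx⟩)

lemma projPos_of_mem_compl {x : L} (hx : x ∈ 𝔥.toSubmodule ⊔ nNeg Δ) : projPos Δ x = 0 :=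
  (Submodule.projectionOnto_apply_eq_zero_iff (isCompl_nPos Δ)).mpr hx

/-- `𝔫₋` is `κ`-orthogonal to `𝔥 ⊕ 𝔫₋`, the kernel of the projection. -/
lemma form_nNeg_projPos (κ : InvForm L) {n : L} (hn : n ∈ nNeg Δ) (y : L) :
    κ.form n (projPos Δ y) = κ.form n y := by
  obtain ⟨p, hp, h, hh, m, hm, rfl⟩ := exists_triangular Δ y
  have h1 : projPos Δ (h + m) = 0 :=
    projPos_of_mem_compl Δ (Submodule.add_mem_sup hh hm)
  rw [add_assoc, map_add, h1, add_zero, projPos_of_mem_nPos Δ hp, map_add, map_add,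
    form_nNeg_cartan Δ κ hn hh, form_nNeg_nNeg Δ κ hn hm, add_zero, add_zero]

lemma exists_form_eq (κ : InvForm L) (φ : L →ₗ[ℂ] ℂ) : ∃ v, ∀ y, φ y = κ.form v y := by
  refine ⟨(κ.form.toDual κ.nondegenerate).symm φ, fun y ↦ ?_⟩
  rw [LinearMap.BilinForm.apply_toDual_symm_apply]

/-- The identity behind the bracket formula: for an isometry `A` of `κ` that preserves `𝔫₊` and
induces the identity on `𝔟₊ / 𝔫₊`, and forms `φ`, `ψ` that agree on `𝔥` with their pullbacks
by `A`. -/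
theorem pairing_rStd_sub (κ : InvForm L) (A A' : L →ₗ[ℂ] L)
    (hAA' : ∀ y, A (A' y) = y)
    (hκ : ∀ y z, κ.form (A y) (A z) = κ.form y z)
    (hn : ∀ y ∈ nPos Δ, A y ∈ nPos Δ) (hh : ∀ y ∈ 𝔥, A y - y ∈ nPos Δ)
    (φ ψ : L →ₗ[ℂ] ℂ) (hφ : ∀ y ∈ 𝔥, φ (A y) = φ y) (hψ : ∀ y ∈ 𝔥, ψ (A y) = ψ y) :
    pairing (rStd κ Δ) φ ψ - pairing (rStd κ Δ) (φ ∘ₗ A) (ψ ∘ₗ A) =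
      pairing (TensorProduct.map LinearMap.id A' (rOne κ Δ))
        (φ ∘ₗ (nPos Δ).subtype ∘ₗ projPos Δ) ((ψ ∘ₗ A) ∘ₗ (nPos Δ).subtype ∘ₗ projPos Δ) := by
  have hsymm : ∀ y z, κ.form y z = κ.form z y := fun y z ↦ by
    simpa using κ.symm.eq y z
  have hκ' : ∀ y z, κ.form (A y) z = κ.form y (A' z) := fun y z ↦ by
    rw [← hκ y (A' z), hAA']
  obtain ⟨v, hv⟩ := exists_form_eq κ ψ
  obtain ⟨p, hp, h, hhm, n, hnm, hdec⟩ := exists_triangular Δ v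
  obtain ⟨p', hp', h', hhm', n', hnm', hdec'⟩ := exists_triangular Δ (A' v)
  have hv' : ∀ y, ψ (A y) = κ.form (A' v) y := fun y ↦ by
    rw [hv, hsymm, hκ', hsymm]
  -- Each of `𝔫₋`, `𝔥`, `𝔫₊` detects under `κ` exactly one component of a vector: the one in `𝔫₊`,
  -- `𝔥`, `𝔫₋` respectively.
  have rep_pos : ∀ {p h n : L}, p ∈ nPos Δ → h ∈ 𝔥 → n ∈ nNeg Δ → ∀ y ∈ nNeg Δ,
      κ.form (p + h + n) y = κ.form p y := fun {p h n} _ hh hn y hy ↦ by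
    rw [map_add, map_add, LinearMap.add_apply, LinearMap.add_apply, form_nNeg_nNeg Δ κ hn hy,
      hsymm h y, form_nNeg_cartan Δ κ hy hh, add_zero, add_zero]
  have rep_zero : ∀ {p h n : L}, p ∈ nPos Δ → h ∈ 𝔥 → n ∈ nNeg Δ → ∀ y ∈ 𝔥,
      κ.form (p + h + n) y = κ.form h y := fun {p h n} hp _ hn y hy ↦ by
    rw [map_add, map_add, LinearMap.add_apply, LinearMap.add_apply, form_nPos_cartan Δ κ hp hy,
      form_nNeg_cartan Δ κ hn hy, add_zero, zero_add]
  have rep_neg : ∀ {p h n : L}, p ∈ nPos Δ → h ∈ 𝔥 → n ∈ nNeg Δ → ∀ y ∈ nPos Δ,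
      κ.form (p + h + n) y = κ.form n y := fun {p h n} hp hh _ y hy ↦ by
    rw [map_add, map_add, LinearMap.add_apply, LinearMap.add_apply, form_nPos_nPos Δ κ hp hy,
      hsymm h y, form_nPos_cartan Δ κ hy hh, add_zero, zero_add]
  have hr1 : pairing (rOne κ Δ) φ ψ = φ p :=
    pairing_canonicalElement κ _ _ _ φ ψ hp fun y hy ↦ by
      rw [hv, hdec, rep_pos hp hhm hnm y hy]
  have hr0 : pairing (rZero κ 𝔥) φ ψ = φ h :=
    pairing_canonicalElement κ _ _ _ φ ψ hhm fun y hy ↦ by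
      rw [hv, hdec, rep_zero hp hhm hnm y hy]
  have hr1' : pairing (rOne κ Δ) (φ ∘ₗ A) (ψ ∘ₗ A) = φ (A p') :=
    pairing_canonicalElement κ _ _ _ (φ ∘ₗ A) (ψ ∘ₗ A) hp' fun y hy ↦ by
      rw [LinearMap.comp_apply, hv', hdec', rep_pos hp' hhm' hnm' y hy]
  have hr0' : pairing (rZero κ 𝔥) (φ ∘ₗ A) (ψ ∘ₗ A) = φ (A h') :=
    pairing_canonicalElement κ _ _ _ (φ ∘ₗ A) (ψ ∘ₗ A) hhm' fun y hy ↦ by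
      rw [LinearMap.comp_apply, hv', hdec', rep_zero hp' hhm' hnm' y hy]
  -- `ψ` and `ψA` agree on `𝔥`, where `κ` is nondegenerate.
  have hhh : h' = h := by
    have hinj := (isPerfPair_cartan κ 𝔥).bijective_left.injective
    have : (⟨h', hhm'⟩ : 𝔥.toSubmodule) = ⟨h, hhm⟩ := by
      apply hinj
      ext y
      change κ.form h' y = κ.form h y
      rw [← rep_zero hp' hhm' hnm' y y.2, ← rep_zero hp hhm hnm y y.2, ← hdec, ← hdec', ← hv',
        ← hv, hψ _ y.2]
    exact congrArg Subtype.val this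
  subst hhh
  have hstd : ∀ φ ψ : L →ₗ[ℂ] ℂ, pairing (rStd κ Δ) φ ψ =
      1 / 2 * pairing (rZero κ 𝔥) φ ψ + pairing (rOne κ Δ) φ ψ := fun φ ψ ↦ by
    simp [pairing, rStd]
  -- `A'` is the `κ`-adjoint of `A`. With `π` the projection onto `𝔫₊`, for `y ∈ 𝔫₋` one has
  -- `ψ(Aπ(A'y)) = κ(n', A'y) = κ(An', y) = κ(π(An'), y)`, so `π(An')` is the representing vector.
  have htarget : pairing (TensorProduct.map LinearMap.id A' (rOne κ Δ))
      (φ ∘ₗ (nPos Δ).subtype ∘ₗ projPos Δ) ((ψ ∘ₗ A) ∘ₗ (nPos Δ).subtype ∘ₗ projPos Δ) =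
      φ (projPos Δ (A n')) := by
    rw [pairing_map]
    refine (pairing_canonicalElement κ _ _ _ _ _ (projPos Δ (A n')).2 fun y hy ↦ ?_).trans ?_
    · change _ = ψ (A (projPos Δ (A' y)))
      rw [hv', hdec', rep_neg hp' hhm' hnm' _ (projPos Δ (A' y)).2, form_nNeg_projPos Δ κ hnm',
        ← hκ', hsymm, form_nNeg_projPos Δ κ hy, hsymm]
    · change φ (projPos Δ (projPos Δ (A n') : L)) = _
      rw [projPos_of_mem_nPos Δ (projPos Δ (A n')).2]
  have hAn : A n' = (p - (A h' - h') - A p') + n := by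
    have : A (p' + h' + n') = p + h' + n := by rw [← hdec', hAA', hdec]
    rw [map_add, map_add] at this
    rw [eq_sub_of_add_eq' this]
    abel
  have hproj : (projPos Δ (A n') : L) = p - (A h' - h') - A p' := by
    rw [hAn, map_add, projPos_of_mem_compl Δ (Submodule.mem_sup_right hnm), add_zero,
      projPos_of_mem_nPos Δ (sub_mem (sub_mem hp (hh _ hhm')) (hn _ hp'))]
  rw [htarget, hproj, hstd, hstd, hr1, hr0, hr1', hr0', hφ _ hhm']
  simp only [map_sub, hφ _ hhm']
  ring

end LieAlgebraPart

/-! ### Conjugation by exponentials. -/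

section GroupPart

/-- Conjugate `(a, a)` by `exp (ξ, 0) = (exp ξ, 1)` in `A × A`: the second entry keeps the original
`a`, and the subspace of pairs `(c, d)` with `d ∈ ℂa` and `c - d ∈ W` is stable under the commutator
with `(ξ, 0)`. -/
lemma exp_conj_sub_mem {A : Type*} [NormedRing A] [NormedAlgebra ℂ A] [FiniteDimensional ℂ A]
    (W : Submodule ℂ A) {ξ a : A} (hξ : ∀ c ∈ W, ξ * c - c * ξ ∈ W) (ha : ξ * a - a * ξ ∈ W) :
    NormedSpace.exp ξ * a * NormedSpace.exp (-ξ) - a ∈ W := by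
  have : CompleteSpace A := FiniteDimensional.complete ℂ A
  let _ : NormedAlgebra ℚ A := NormedAlgebra.restrictScalars ℚ ℂ _
  let W' : Submodule ℂ (A × A) :=
    (Submodule.span ℂ {a}).comap (LinearMap.snd ℂ A A) ⊓
      W.comap (LinearMap.fst ℂ A A - LinearMap.snd ℂ A A)
  have h := exp_conj_mem W' (Submodule.closed_of_finiteDimensional _) (ξ := (ξ, 0)) (a := (a, a))
    (fun c hc ↦ ?_) ⟨Submodule.mem_span_singleton_self a, by simp⟩
  · have h2 := h.2
    simpa [Prod.fst_exp, Prod.snd_exp] using h2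
  · obtain ⟨c, d⟩ := c
    obtain ⟨h1, h2⟩ := hc
    obtain ⟨z, rfl⟩ := Submodule.mem_span_singleton.mp h1
    replace h2 : c - z • a ∈ W := h2
    refine ⟨by simp, ?_⟩
    have h3 := add_mem (hξ _ h2) (W.smul_mem z ha)
    have h4 : ξ * (c - z • a) - (c - z • a) * ξ + z • (ξ * a - a * ξ) = ξ * c - c * ξ := by
      simp only [mul_sub, sub_mul, smul_sub, mul_smul_comm, smul_mul_assoc]
      abel
    rw [h4] at h3
    simpa using h3

/-- Conjugation by `e^ξ` preserves a bilinear form for which `ad ξ` is skew. -/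
lemma bilin_exp_conj {A : Type*} [NormedRing A] [NormedAlgebra ℂ A] [FiniteDimensional ℂ A]
    (B : A →ₗ[ℂ] A →ₗ[ℂ] ℂ) (W : Submodule ℂ A) {ξ : A} (hξ : ∀ c ∈ W, ξ * c - c * ξ ∈ W)
    (hB : ∀ c ∈ W, ∀ d ∈ W, B (ξ * c - c * ξ) d + B c (ξ * d - d * ξ) = 0)
    {a b : A} (ha : a ∈ W) (hb : b ∈ W) :
    B (NormedSpace.exp ξ * a * NormedSpace.exp (-ξ)) (NormedSpace.exp ξ * b * NormedSpace.exp (-ξ))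
      = B a b := by
  have : CompleteSpace A := FiniteDimensional.complete ℂ A
  let c : A → ℂ → A := fun y t ↦ NormedSpace.exp (t • ξ) * y * NormedSpace.exp (t • -ξ)
  have hc : ∀ y t, HasDerivAt (c y) (ξ * c y t - c y t * ξ) t := fun y t ↦ by
    have h1 := ((hasDerivAt_exp_smul_const' (𝕂 := ℂ) ξ t).mul_const y).mul
      (hasDerivAt_exp_smul_const (𝕂 := ℂ) (-ξ) t)
    refine h1.congr_deriv ?_
    simp only [c, mul_assoc, mul_neg]
    abel
  have hmem : ∀ y ∈ W, ∀ t, c y t ∈ W := fun y hy t ↦ by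
    have h2 := exp_conj_mem W (Submodule.closed_of_finiteDimensional _) (ξ := t • ξ)
      (fun d hd ↦ by
        rw [smul_mul_assoc, mul_smul_comm, ← smul_sub]; exact W.smul_mem t (hξ d hd)) hy
    simpa only [c, smul_neg] using h2
  let Bc : A →L[ℂ] A →L[ℂ] ℂ :=
    LinearMap.toContinuousLinearMap (LinearMap.toContinuousLinearMap.toLinearMap ∘ₗ B)
  have hBc : ∀ y z, Bc y z = B y z := fun y z ↦ rfl
  -- Skewness makes the form constant along the conjugation flow; times `1` and `0` are then
  -- compared.
  have hder : ∀ t, HasDerivAt (fun s ↦ Bc (c a s) (c b s)) 0 t := fun t ↦ by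
    have h3 := (Bc.hasFDerivAt.comp_hasDerivAt t (hc a t)).clm_apply (hc b t)
    refine h3.congr_deriv ?_
    simpa only [hBc, Function.comp_apply] using hB _ (hmem a ha t) _ (hmem b hb t)
  have h4 := is_const_of_deriv_eq_zero (fun t ↦ (hder t).differentiableAt)
    (fun t ↦ (hder t).deriv) 1 0
  simpa [c, hBc] using h4

variable {V : Type*} [NormedAddCommGroup V] [NormedSpace ℂ V] [FiniteDimensional ℂ V]

/-! ### Differentials on the group through an ambient function. -/

section Differentials

variable {𝔨 : Submodule ℂ (V →L[ℂ] V)}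

lemma continuous_expK : Continuous (expK : 𝔨 → expGroup 𝔨) := by
  have : CompleteSpace V := FiniteDimensional.complete ℂ V
  let _ : NormedAlgebra ℚ (V →L[ℂ] V) := NormedAlgebra.restrictScalars ℚ ℂ _
  refine Continuous.subtype_mk (Units.continuous_iff.mpr ⟨?_, ?_⟩) _
  · exact NormedSpace.exp_continuous.comp continuous_subtype_val
  · exact NormedSpace.exp_continuous.comp continuous_subtype_val.neg

lemma expK_zero : expK (0 : 𝔨) = 1 := by
  refine Subtype.ext (Units.ext ?_)
  change NormedSpace.exp (((0 : 𝔨) : V →L[ℂ] V)) = 1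
  simp

lemma hasFDerivAt_exp_coe :
    HasFDerivAt (fun ξ : 𝔨 ↦ NormedSpace.exp (ξ : V →L[ℂ] V)) 𝔨.subtypeL 0 := by
  have : CompleteSpace V := FiniteDimensional.complete ℂ V
  have h1 : HasFDerivAt (NormedSpace.exp : (V →L[ℂ] V) → _) (1 : (V →L[ℂ] V) →L[ℂ] _)
    (𝔨.subtypeL 0) := by
    rw [map_zero]; exact hasFDerivAt_exp_zero
  exact h1.comp (0 : 𝔨) 𝔨.subtypeL.hasFDerivAt

variable {f : expGroup 𝔨 → ℂ} {x : expGroup 𝔨} {F : (V →L[ℂ] V) → ℂ}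

/-- The chain rule, with `exp` having derivative the identity at `0`. Left and right differentials,
on `G` and on `B⁺`, thus all become values of one derivative on `End V`. -/
lemma diffLeft_apply (hF : AnalyticAt ℂ F ((x : (V →L[ℂ] V)ˣ) : V →L[ℂ] V))
    (hf : ∀ᶠ y in 𝓝 x, f y = F ((y : (V →L[ℂ] V)ˣ) : V →L[ℂ] V)) (ξ : 𝔨) :
    diffLeft f x ξ = fderiv ℂ F ((x : (V →L[ℂ] V)ˣ) : V →L[ℂ] V)
      ((ξ : V →L[ℂ] V) * ((x : (V →L[ℂ] V)ˣ) : V →L[ℂ] V)) := by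
  have hc : Filter.Tendsto (fun ξ : 𝔨 ↦ expK ξ * x) (𝓝 0) (𝓝 x) := by
    have h : Continuous fun ξ : 𝔨 ↦ expK ξ * x := continuous_expK.mul continuous_const
    simpa [expK_zero] using h.tendsto 0
  have h1 := ((ContinuousLinearMap.mul ℂ (V →L[ℂ] V)).flip
    ((x : (V →L[ℂ] V)ˣ) : V →L[ℂ] V)).hasFDerivAt.comp (0 : 𝔨) hasFDerivAt_exp_coe
  have h2 : HasFDerivAt F (fderiv ℂ F ((x : (V →L[ℂ] V)ˣ) : V →L[ℂ] V))
      (NormedSpace.exp ((0 : 𝔨) : V →L[ℂ] V) * ((x : (V →L[ℂ] V)ˣ) : V →L[ℂ] V)) := by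
    simpa using hF.differentiableAt.hasFDerivAt
  have h3 := (h2.comp (0 : 𝔨) h1).congr_of_eventuallyEq (hc.eventually hf)
  rw [diffLeft, diffZero, h3.fderiv]
  simp

lemma diffRight_apply (hF : AnalyticAt ℂ F ((x : (V →L[ℂ] V)ˣ) : V →L[ℂ] V))
    (hf : ∀ᶠ y in 𝓝 x, f y = F ((y : (V →L[ℂ] V)ˣ) : V →L[ℂ] V)) (ξ : 𝔨) :
    diffRight f x ξ = fderiv ℂ F ((x : (V →L[ℂ] V)ˣ) : V →L[ℂ] V)
      (((x : (V →L[ℂ] V)ˣ) : V →L[ℂ] V) * (ξ : V →L[ℂ] V)) := by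
  have hc : Filter.Tendsto (fun ξ : 𝔨 ↦ x * expK ξ) (𝓝 0) (𝓝 x) := by
    have h : Continuous fun ξ : 𝔨 ↦ x * expK ξ := continuous_const.mul continuous_expK
    simpa [expK_zero] using h.tendsto 0
  have h1 := ((ContinuousLinearMap.mul ℂ (V →L[ℂ] V))
    ((x : (V →L[ℂ] V)ˣ) : V →L[ℂ] V)).hasFDerivAt.comp (0 : 𝔨) hasFDerivAt_exp_coe
  have h2 : HasFDerivAt F (fderiv ℂ F ((x : (V →L[ℂ] V)ˣ) : V →L[ℂ] V))
      (((x : (V →L[ℂ] V)ˣ) : V →L[ℂ] V) * NormedSpace.exp ((0 : 𝔨) : V →L[ℂ] V)) := by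
    simpa using hF.differentiableAt.hasFDerivAt
  have h3 := (h2.comp (0 : 𝔨) h1).congr_of_eventuallyEq (hc.eventually hf)
  rw [diffRight, diffZero, h3.fderiv]
  simp

end Differentials

/-! ### The adjoint action of `G` and `B⁺`. -/

variable {𝔤 : LieSubalgebra ℂ (V →L[ℂ] V)}

lemma Ad_mul (x y : groupG 𝔤) (a : 𝔤) : Ad (x * y) a = Ad x (Ad y a) := by
  ext1
  simp [Ad, mul_assoc]

lemma Ad_one (a : 𝔤) : Ad (1 : groupG 𝔤) a = a := by
  ext1
  simp [Ad]

lemma Ad_Ad_inv (x : groupG 𝔤) (a : 𝔤) : Ad x (Ad x⁻¹ a) = a := by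
  rw [← Ad_mul, mul_inv_cancel, Ad_one]

lemma form_Ad (κ : InvForm 𝔤) (x : groupG 𝔤) (a b : 𝔤) :
    κ.form (Ad x a) (Ad x b) = κ.form a b := by
  obtain ⟨u, hu⟩ := x
  induction hu using Subgroup.closure_induction generalizing a b with
  | mem v hv =>
    obtain ⟨ξ, hξ, rfl⟩ := hv
    -- A linear retraction of `gl(V)` onto `𝔤` extends `κ` to `gl(V)`, where the conjugation takes
    -- place.
    obtain ⟨p, hp⟩ := 𝔤.toSubmodule.subtype.exists_leftInverse_of_injective
      (LinearMap.ker_eq_bot.mpr 𝔤.toSubmodule.injective_subtype)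
    have hp' : ∀ c : 𝔤, p (c : V →L[ℂ] V) = c := fun c ↦ LinearMap.congr_fun hp c
    let B : (V →L[ℂ] V) →ₗ[ℂ] (V →L[ℂ] V) →ₗ[ℂ] ℂ := κ.form.compl₁₂ p p
    have hB : ∀ c d : 𝔤, B c d = κ.form c d := fun c d ↦ by
      change κ.form (p c) (p d) = _
      rw [hp', hp']
    have h := bilin_exp_conj B 𝔤.toSubmodule (ξ := ξ) (fun c hc ↦ 𝔤.lie_mem hξ hc)
      (fun c hc d hd ↦ by
        have h1 := κ.invariant ⟨ξ, hξ⟩ ⟨c, hc⟩ ⟨d, hd⟩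
        rw [← hB, ← hB] at h1
        exact eq_neg_iff_add_eq_zero.mp h1) a.2 b.2
    rw [← hB, ← hB]
    exact h
  | one => exact congrArg₂ (fun c d ↦ κ.form c d) (Ad_one a) (Ad_one b)
  | mul v w hv hw ihv ihw =>
    have h1 := Ad_mul (𝔤 := 𝔤) ⟨v, hv⟩ ⟨w, hw⟩
    exact (congrArg₂ (fun c d ↦ κ.form c d) (h1 a) (h1 b)).trans ((ihv _ _).trans (ihw _ _))
  | inv v hv ih =>
    have h1 := Ad_Ad_inv (𝔤 := 𝔤) ⟨v, hv⟩
    exact (ih _ _).symm.trans (congrArg₂ (fun c d ↦ κ.form c d) (h1 a) (h1 b))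

variable [LieAlgebra.IsKilling ℂ 𝔤] {𝔥 : LieSubalgebra ℂ 𝔤} [𝔥.IsCartanSubalgebra]
  (Δ : (LieAlgebra.IsKilling.rootSystem 𝔥).Base)

lemma Ad_exp_sub_mem_nPos {ξ : 𝔤} (hξ : ξ ∈ bPos Δ) {a : 𝔤} (ha : a ∈ bPos Δ) :
    Ad (expK (𝔨 := 𝔤.toSubmodule) ξ) a - a ∈ nPos Δ := by
  have h := exp_conj_sub_mem (ambient (nPos Δ)) (ξ := (ξ : V →L[ℂ] V)) (a := (a : V →L[ℂ] V)) ?_ ?_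
  · obtain ⟨c, hc, hc'⟩ := h
    have : c = Ad (expK (𝔨 := 𝔤.toSubmodule) ξ) a - a := Subtype.ext hc'
    exact this ▸ hc
  · rintro _ ⟨c, hc, rfl⟩
    exact ⟨⁅ξ, c⁆, lie_bPos_nPos Δ hξ hc, rfl⟩
  · exact ⟨⁅ξ, a⁆, lie_bPos_bPos Δ hξ ha, rfl⟩

lemma Ad_sub_mem_nPos (x : groupB Δ) {a : 𝔤} (ha : a ∈ bPos Δ) :
    Ad (inclBG Δ x) a - a ∈ nPos Δ := by
  obtain ⟨u, hu⟩ := x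
  have hsub : ∀ {b c : 𝔤}, b ∈ bPos Δ → c - b ∈ nPos Δ → c ∈ bPos Δ := fun {b c} hb hc ↦ by
    rw [← sub_add_cancel c b]
    exact add_mem (Submodule.mem_sup_right hc) hb
  -- Carrying the inverse along makes the inversion step of the induction a mere swap. Products
  -- telescope: `vwa - a = (v(wa) - wa) + (wa - a)`, with `wa` still in `𝔟₊`.
  suffices h : ∀ a ∈ bPos Δ, Ad (inclBG Δ ⟨u, hu⟩) a - a ∈ nPos Δ ∧
      Ad (inclBG Δ ⟨u, hu⟩)⁻¹ a - a ∈ nPos Δ from (h a ha).1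
  clear ha a
  induction hu using Subgroup.closure_induction with
  | mem v hv =>
    obtain ⟨_, ⟨ξ, hξ, rfl⟩, rfl⟩ := hv
    intro a ha
    refine ⟨Ad_exp_sub_mem_nPos Δ hξ ha, ?_⟩
    have h := Ad_exp_sub_mem_nPos Δ (neg_mem hξ) ha
    have h1 : (expK (𝔨 := 𝔤.toSubmodule) ξ)⁻¹ = expK (𝔨 := 𝔤.toSubmodule) (-ξ) :=
      Subtype.ext (Units.ext rfl)
    rw [← h1] at h
    exact h
  | one =>
    intro a _
    have h1 : inclBG Δ ⟨1, one_mem _⟩ = 1 := rfl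
    rw [h1, inv_one, Ad_one, sub_self]
    exact ⟨zero_mem _, zero_mem _⟩
  | mul v w hv hw ihv ihw =>
    intro a ha
    have h1 : inclBG Δ ⟨v * w, mul_mem hv hw⟩ = inclBG Δ ⟨v, hv⟩ * inclBG Δ ⟨w, hw⟩ := rfl
    rw [h1, mul_inv_rev, Ad_mul, Ad_mul]
    constructor
    · have h2 := (ihw a ha).1
      have h3 := add_mem (ihv _ (hsub ha h2)).1 h2
      rwa [sub_add_sub_cancel] at h3
    · have h2 := (ihv a ha).2
      have h3 := add_mem (ihw _ (hsub ha h2)).2 h2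
      rwa [sub_add_sub_cancel] at h3
  | inv v hv ih =>
    intro a ha
    have h1 : inclBG Δ ⟨v⁻¹, inv_mem hv⟩ = (inclBG Δ ⟨v, hv⟩)⁻¹ := rfl
    rw [h1, inv_inv]
    exact (ih a ha).symm

lemma Ad_mem_nPos (x : groupB Δ) {a : 𝔤} (ha : a ∈ nPos Δ) : Ad (inclBG Δ x) a ∈ nPos Δ := by
  rw [← sub_add_cancel (Ad (inclBG Δ x) a) a]
  exact add_mem (Ad_sub_mem_nPos Δ x (Submodule.mem_sup_right ha)) ha

lemma continuous_inclBG : Continuous (inclBG (𝔤 := 𝔤) Δ) :=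
  Continuous.subtype_mk continuous_subtype_val _

lemma continuous_inclHB : Continuous (inclHB (𝔤 := 𝔤) Δ) :=
  Continuous.subtype_mk continuous_subtype_val _

/-- The infinitesimal form of `Ad_H`-invariance. -/
lemma fderiv_commutator_eq_zero {U : Set (groupB Δ)} (hU : IsOpen U) {f : groupB Δ → ℂ}
    (hf : AdHInvariantOn Δ f U) {x : groupB Δ} (hx : x ∈ U) {F : (V →L[ℂ] V) → ℂ}
    (hF : AnalyticAt ℂ F ((x : (V →L[ℂ] V)ˣ) : V →L[ℂ] V))
    (hfF : ∀ᶠ y in 𝓝 x, f y = F ((y : (V →L[ℂ] V)ˣ) : V →L[ℂ] V)) {a : 𝔤} (ha : a ∈ 𝔥) :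
    fderiv ℂ F ((x : (V →L[ℂ] V)ˣ) : V →L[ℂ] V)
      ((a : V →L[ℂ] V) * ((x : (V →L[ℂ] V)ˣ) : V →L[ℂ] V)) =
    fderiv ℂ F ((x : (V →L[ℂ] V)ˣ) : V →L[ℂ] V)
      (((x : (V →L[ℂ] V)ˣ) : V →L[ℂ] V) * (a : V →L[ℂ] V)) := by
  have : CompleteSpace V := FiniteDimensional.complete ℂ V
  set X : V →L[ℂ] V := ((x : (V →L[ℂ] V)ˣ) : V →L[ℂ] V) with hX
  let a' : ambient 𝔥.toSubmodule := ⟨a, a, ha, rfl⟩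
  let γ : ℂ → groupB Δ := fun t ↦ inclHB Δ (expK (t • a')) * x * (inclHB Δ (expK (t • a')))⁻¹
  have hγ : Filter.Tendsto γ (𝓝 0) (𝓝 x) := by
    have h1 : Continuous fun t : ℂ ↦ inclHB Δ (expK (t • a')) :=
      (continuous_inclHB Δ).comp (continuous_expK.comp (continuous_id.smul continuous_const))
    have h2 : Continuous γ := (h1.mul continuous_const).mul h1.inv
    simpa [γ, expK_zero] using h2.tendsto 0
  have hγval : ∀ t, ((γ t : (V →L[ℂ] V)ˣ) : V →L[ℂ] V) =
      NormedSpace.exp (t • (a : V →L[ℂ] V)) * X * NormedSpace.exp (t • -(a : V →L[ℂ] V)) :=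
    fun t ↦ by rw [smul_neg]; rfl
  -- Openness of `U` keeps the conjugates of `x` by `e^{ta}` in `U` for small `t`, so invariance
  -- applies. The derivative at `0`, which is `dF(aX - Xa)`, therefore vanishes.
  have hconst : (fun t : ℂ ↦ F (NormedSpace.exp (t • (a : V →L[ℂ] V)) * X *
      NormedSpace.exp (t • -(a : V →L[ℂ] V)))) =ᶠ[𝓝 0] fun _ ↦ f x := by
    filter_upwards [hγ.eventually hfF, hγ.eventually (hU.mem_nhds hx)] with t ht htU
    rw [← hγval, ← ht]
    exact hf _ x hx htU
  have h1 := ((hasDerivAt_exp_smul_const' (𝕂 := ℂ) (a : V →L[ℂ] V) 0).mul_const X).mul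
    (hasDerivAt_exp_smul_const (𝕂 := ℂ) (-(a : V →L[ℂ] V)) 0)
  have h2 : HasFDerivAt F (fderiv ℂ F X) (NormedSpace.exp ((0 : ℂ) • (a : V →L[ℂ] V)) * X *
      NormedSpace.exp ((0 : ℂ) • -(a : V →L[ℂ] V))) := by
    simpa using hF.differentiableAt.hasFDerivAt
  have h3 := (h2.comp_hasDerivAt (0 : ℂ) h1).unique
    ((hasDerivAt_const (0 : ℂ) (f x)).congr_of_eventuallyEq hconst)
  rw [← sub_eq_zero, ← map_sub, ← h3]
  simp [sub_eq_add_neg]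

end GroupPart

end StandardPoisson

/-! ### The bracket formula. -/

open StandardPoisson in
theorem mainTheorem12
    {V : Type*} [NormedAddCommGroup V] [NormedSpace ℂ V] [FiniteDimensional ℂ V]
    (𝔤 : LieSubalgebra ℂ (V →L[ℂ] V)) [LieAlgebra.IsSimple ℂ 𝔤]
    (𝔥 : LieSubalgebra ℂ 𝔤) [𝔥.IsCartanSubalgebra]
    (Δ : (LieAlgebra.IsKilling.rootSystem 𝔥).Base)
    (κ : StandardPoisson.InvForm 𝔤)
    (U : Set (StandardPoisson.groupB Δ)) (hU : IsOpen U)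
    (f g : StandardPoisson.groupB Δ → ℂ)
    (hf : ∀ x ∈ U, StandardPoisson.HolomorphicAt f x)
    (hg : ∀ x ∈ U, StandardPoisson.HolomorphicAt g x)
    (hf_inv : StandardPoisson.AdHInvariantOn Δ f U)
    (hg_inv : StandardPoisson.AdHInvariantOn Δ g U) :
    ∀ x ∈ U, StandardPoisson.HasBracketAt κ Δ f g x
      (StandardPoisson.pairing
        (TensorProduct.map LinearMap.id (StandardPoisson.Ad (StandardPoisson.inclBG Δ x)⁻¹)
          (StandardPoisson.rOne κ Δ))
        (StandardPoisson.dPlus Δ f x) (StandardPoisson.dPlus' Δ g x)) := by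
  intro x hx
  have hext : ∀ f : groupB Δ → ℂ, HolomorphicAt f x → ∃ F, IsExtensionAt Δ f x F := by
    rintro f ⟨F, hF, hfF⟩
    exact ⟨fun y ↦ F ((y : (V →L[ℂ] V)ˣ) : V →L[ℂ] V),
      ⟨F, hF, Filter.Eventually.of_forall fun _ ↦ rfl⟩, hfF.mono fun _ hy ↦ hy.symm⟩
  refine ⟨hext f (hf x hx), hext g (hg x hx), ?_⟩
  rintro F₁ F₂ ⟨⟨E₁, hE₁, hF₁⟩, hf₁⟩ ⟨⟨E₂, hE₂, hF₂⟩, hg₂⟩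
  -- The ambient function of the arbitrary extension also represents `f` near `x`, so differentials
  -- on `G` and `B⁺` can be compared through it.
  have hfE : ∀ᶠ y in 𝓝 x, f y = E₁ ((y : (V →L[ℂ] V)ˣ) : V →L[ℂ] V) := by
    filter_upwards [hf₁, ((continuous_inclBG Δ).tendsto x).eventually hF₁] with y h1 h2
    exact h1.symm.trans h2
  have hgE : ∀ᶠ y in 𝓝 x, g y = E₂ ((y : (V →L[ℂ] V)ˣ) : V →L[ℂ] V) := by
    filter_upwards [hg₂, ((continuous_inclBG Δ).tendsto x).eventually hF₂] with y h1 h2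
    exact h1.symm.trans h2
  have hright : ∀ (F : groupG 𝔤 → ℂ) (E : (V →L[ℂ] V) → ℂ),
      AnalyticAt ℂ E ((inclBG Δ x : (V →L[ℂ] V)ˣ) : V →L[ℂ] V) →
      (∀ᶠ y in 𝓝 (inclBG Δ x), F y = E ((y : (V →L[ℂ] V)ˣ) : V →L[ℂ] V)) →
      (diffRight F (inclBG Δ x) : 𝔤 →ₗ[ℂ] ℂ) =
        (diffLeft F (inclBG Δ x) : 𝔤 →ₗ[ℂ] ℂ) ∘ₗ Ad (inclBG Δ x) := by
    intro F E hE hF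
    refine LinearMap.ext fun a ↦ (diffRight_apply hE hF a).trans ?_
    refine Eq.trans ?_ (diffLeft_apply hE hF (Ad (inclBG Δ x) a)).symm
    congr 1
    simp [Ad, mul_assoc]
  have hinv : ∀ (f : groupB Δ → ℂ) (F : groupG 𝔤 → ℂ) (E : (V →L[ℂ] V) → ℂ),
      AdHInvariantOn Δ f U →
      AnalyticAt ℂ E ((inclBG Δ x : (V →L[ℂ] V)ˣ) : V →L[ℂ] V) →
      (∀ᶠ y in 𝓝 (inclBG Δ x), F y = E ((y : (V →L[ℂ] V)ˣ) : V →L[ℂ] V)) →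
      (∀ᶠ y in 𝓝 x, f y = E ((y : (V →L[ℂ] V)ˣ) : V →L[ℂ] V)) →
      ∀ a ∈ 𝔥, (diffLeft F (inclBG Δ x) : 𝔤 →ₗ[ℂ] ℂ) (Ad (inclBG Δ x) a) =
        (diffLeft F (inclBG Δ x) : 𝔤 →ₗ[ℂ] ℂ) a := by
    intro f F E hfi hE hF hfE a ha
    refine (LinearMap.congr_fun (hright F E hE hF) a).symm.trans ?_
    refine (diffRight_apply hE hF a).trans (Eq.trans ?_ (diffLeft_apply hE hF a).symm)
    exact (fderiv_commutator_eq_zero Δ hU hfi hx hE hfE ha).symm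
  have key := pairing_rStd_sub Δ κ (Ad (inclBG Δ x)) (Ad (inclBG Δ x)⁻¹)
    (Ad_Ad_inv (inclBG Δ x)) (form_Ad κ (inclBG Δ x)) (fun y hy ↦ Ad_mem_nPos Δ x hy)
    (fun y hy ↦ Ad_sub_mem_nPos Δ x (Submodule.mem_sup_left hy))
    (diffLeft F₁ (inclBG Δ x)) (diffLeft F₂ (inclBG Δ x))
    (hinv f F₁ E₁ hf_inv hE₁ hF₁ hfE) (hinv g F₂ E₂ hg_inv hE₂ hF₂ hgE)
  rw [← hright F₁ E₁ hE₁ hF₁, ← hright F₂ E₂ hE₂ hF₂] at key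
  -- Independence of the extension: in directions of `𝔫₊ ⊆ 𝔟₊`, the differential of `F₁` is that of
  -- `f`.
  have hd₁ : dPlus Δ f x = (diffLeft F₁ (inclBG Δ x) : 𝔤 →ₗ[ℂ] ℂ) ∘ₗ (nPos Δ).subtype ∘ₗ
      projPos Δ :=
    LinearMap.ext fun a ↦ (diffLeft_apply (x := x) hE₁ hfE (projB Δ a)).trans
      (diffLeft_apply hE₁ hF₁ (projPos Δ a : 𝔤)).symm
  have hd₂ : dPlus' Δ g x = (diffRight F₂ (inclBG Δ x) : 𝔤 →ₗ[ℂ] ℂ) ∘ₗ (nPos Δ).subtype ∘ₗ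
      projPos Δ :=
    LinearMap.ext fun a ↦ (diffRight_apply (x := x) hE₂ hgE (projB Δ a)).trans
      (diffRight_apply hE₂ hF₂ (projPos Δ a : 𝔤)).symm
  rw [hd₁, hd₂]
  exact key
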